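/- Let $\Lambda$ be a set of spectral parameters and let $a_-,b_+,b_-,c_+,c_-:\Lambda\times\Lambda\to\mathbb C$ be the Boltzmann weights of an asymmetric six-vertex model, with $R$-matrix $$R(\lambda_1,\lambda_2)=\begin{pmatrix}1&0&0&0\\0&b_+(\lambda_1,\lambda_2)&c_+(\lambda_1,\lambda_2)&0\\0&c_-(\lambda_1,\lambda_2)&b_-(\lambda_1,\lambda_2)&0\\0&0&0&a_-(\lambda_1,\lambda_2)\end{pmatrix}$$ on $\mathbb C^2\otimes\mathbb C^2$. Suppose that $R$ satisfies the unitarity relation $R_{12}(\lambda_1,\lambda_2)R_{21}(\lambda_2,\lambda_1)=1$ and the Yang--Baxter equation $R_{12}(\lambda_1,\lambda_2)R_{13}(\lambda_1,\lambda_3)R_{23}(\lambda_2,\lambda_3)=R_{23}(\lambda_2,\lambda_3)R_{13}(\lambda_1,\lambda_3)R_{12}(\lambda_1,\lambda_2)$ for all $\lambda_1,\lambda_2,\lambda_3\in\Lambda$. Let $\xi_1,\dots,\xi_L\in\Lambda$ be inhomogeneities, let $1\le l_1<\dots<l_M\le L$, and let $\nu_1,\dots,\nu_M\in\Lambda$ be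 rapidities. Assume that $b_-(\xi_{l_i},\xi_{l_j})\ne0$ for $i\ne j$. Let $C_{l_1\dots l_M}(\nu)$, acting on $V_{l_1}\otimes\dots\otimes V_{l_M}$ with every $V_{l_i}=\mathbb C^2$, be the lower left entry of the monodromy matrix $$R_{a\,l_M}(\nu,\xi_{l_M})\cdots R_{a\,l_1}(\nu,\xi_{l_1})=\begin{pmatrix}A_{l_1\dots l_M}(\nu)&B_{l_1\dots l_M}(\nu)\\C_{l_1\dots l_M}(\nu)&D_{l_1\dots l_M}(\nu)\end{pmatrix}_a ,$$ and define the domain wall partition function of type $C$ by $$Z^{(C)}_M(\{\nu\},\{\xi_l\})=\langle0|\,C_{l_1\dots l_M}(\nu_M)\cdots C_{l_1\dots l_M}(\nu_1)\,|1\rangle,\qquad \langle 0|=\bigotimes_{i=1}^M(1,0)_{l_i},\quad |1\rangle=\bigotimes_{i=1}^M\begin{pmatrix}0\\1\end{pmatrix}_{l_i}.$$ Put $\theta(\xi_p,\xi_q)=a_-(\xi_p,\xi_q)$ if $p<q$ and $\theta(\xi_p,\xi_q)=1$ if $p\ge q$. Then $$Z^{(C)}_M(\{\nu\},\{\xi_l\})=\sum_{\sigma\in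 S_M}\ \prod_{i=1}^M c_-(\nu_i,\xi_{l_{\sigma_i}})\prod_{1\le j<k\le M}\frac{b_-(\nu_k,\xi_{l_{\sigma_j}})\,a_-(\nu_j,\xi_{l_{\sigma_k}})\,\theta(\xi_{l_{\sigma_k}},\xi_{l_{\sigma_j}})}{b_-(\xi_{l_{\sigma_k}},\xi_{l_{\sigma_j}})} .$$ -/

import Mathlib

namespace SixVertex

/-- The Boltzmann weights of the asymmetric six-vertex model, normalised so that the weight
`a₊` equals `1`, as arbitrary complex functions of two spectral parameters in `Λ`. -/
structure Weights (Λ : Type*) where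
  aMinus : Λ → Λ → ℂ
  bPlus : Λ → Λ → ℂ
  bMinus : Λ → Λ → ℂ
  cPlus : Λ → Λ → ℂ
  cMinus : Λ → Λ → ℂ

variable {Λ : Type*}

/-- The `4 × 4` matrix `R(x, y)`. The basis of `ℂ² ⊗ ℂ²` is indexed by `Fin 2 × Fin 2`, where
`0` stands for `(1, 0)ᵗ` and `1` for `(0, 1)ᵗ`; in the order `(0,0), (0,1), (1,0), (1,1)` it is
```
1   0   0   0
0   b₊  c₊  0
0   c₋  b₋  0
0   0   0   a₋
```
-/
def Weights.R (w : Weights Λ) (x y : Λ) : Matrix (Fin 2 × Fin 2) (Fin 2 × Fin 2) ℂ :=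
  fun p q =>
    match p, q with
    | (0, 0), (0, 0) => 1
    | (0, 1), (0, 1) => w.bPlus x y
    | (0, 1), (1, 0) => w.cPlus x y
    | (1, 0), (0, 1) => w.cMinus x y
    | (1, 0), (1, 0) => w.bMinus x y
    | (1, 1), (1, 1) => w.aMinus x y
    | _, _ => 0

/-- Operators on the tensor product of the two-dimensional spaces `V_i`, `i ∈ ι`, as matrices in
the standard basis, which is indexed by the configurations `ι → Fin 2`. -/
abbrev Op (ι : Type*) := Matrix (ι → Fin 2) (ι → Fin 2) ℂ

/-- The operator `R_{ij}(x, y)`: it acts as `R(x, y)` on `V_i ⊗ V_j` (first factor `V_i`) and as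
the identity on all other factors. Used for `i ≠ j` only. -/
def Weights.RAt (w : Weights Λ) {ι : Type*} [Fintype ι] [DecidableEq ι] (i j : ι) (x y : Λ) :
    Op ι :=
  fun s t => if ∀ k, k ≠ i → k ≠ j → s k = t k then w.R x y (s i, s j) (t i, t j) else 0

/-- Unitarity: `R₁₂(x, y) R₂₁(y, x) = 1` on `V₁ ⊗ V₂`. -/
def Weights.Unitarity (w : Weights Λ) : Prop :=
  ∀ x y : Λ, w.RAt (0 : Fin 2) 1 x y * w.RAt (1 : Fin 2) 0 y x = 1

/-- The Yang-Baxter equation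
`R₁₂(x, y) R₁₃(x, z) R₂₃(y, z) = R₂₃(y, z) R₁₃(x, z) R₁₂(x, y)` on `V₁ ⊗ V₂ ⊗ V₃`. -/
def Weights.YangBaxter (w : Weights Λ) : Prop :=
  ∀ x y z : Λ,
    w.RAt (0 : Fin 3) 1 x y * w.RAt (0 : Fin 3) 2 x z * w.RAt (1 : Fin 3) 2 y z =
      w.RAt (1 : Fin 3) 2 y z * w.RAt (0 : Fin 3) 2 x z * w.RAt (0 : Fin 3) 1 x y

/-- The monodromy matrix `T_a(μ) = R_{aN}(μ, ξ_N) ⋯ R_{a2}(μ, ξ_2) R_{a1}(μ, ξ_1)`. The auxiliary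
space is the factor with index `0`, the `N` sites are the factors with indices `i.succ`. -/
def Weights.monodromy (w : Weights Λ) {N : ℕ} (ξ : Fin N → Λ) (μ : Λ) : Op (Fin (N + 1)) :=
  (List.ofFn fun i : Fin N => w.RAt (0 : Fin (N + 1)) i.succ μ (ξ i)).reverse.prod

/-- The operator `C(μ)`: the lower left entry of the monodromy matrix, written as a `2 × 2`
matrix over the auxiliary space. -/
def Weights.C (w : Weights Λ) {N : ℕ} (ξ : Fin N → Λ) (μ : Λ) : Op (Fin N) :=
  fun s t => w.monodromy ξ μ (Fin.cons 1 s) (Fin.cons 0 t)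

/-- The state `⊗ (1, 0)`. -/
def state0 (N : ℕ) : (Fin N → Fin 2) → ℂ := Pi.single (fun _ => 0) 1

/-- The state `⊗ (0, 1)`. -/
def state1 (N : ℕ) : (Fin N → Fin 2) → ℂ := Pi.single (fun _ => 1) 1

/-- The domain wall partition function of type `C`,
`⟨0| C(ν_M) ⋯ C(ν_2) C(ν_1) |1⟩`, on `M` sites with inhomogeneities `ξ_1, …, ξ_M`. -/
noncomputable def Weights.ZC (w : Weights Λ) {M : ℕ} (ν ξ : Fin M → Λ) : ℂ :=
  state0 M ⬝ᵥ ((List.ofFn fun i : Fin M => w.C ξ (ν i)).reverse.prod).mulVec (state1 M)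

/-- `θ(ξ_j, ξ_k)`, which depends on the order of the labels: `a₋(ξ_j, ξ_k)` if `j < k`, and `1`
if `j ≥ k`. -/
def Weights.theta (w : Weights Λ) {L : ℕ} (ξ : Fin L → Λ) (j k : Fin L) : ℂ :=
  if j < k then w.aMinus (ξ j) (ξ k) else 1

end SixVertex

namespace SixVertex

variable {Λ : Type*}

/-! Read the lattice by columns. As `⟨0|` fixes the outgoing state `0` at every site, only two
entries `A`, `B` of the column monodromy matrix occur, and the partition function is a matrix
element of `B(ξ_M) ⋯ B(ξ_1)` (`exists_columns`).

Along the row of `ν_1` the auxiliary state changes from `0` to `1`. In `addRowB` this happens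
exactly once, in a column with weight `c₋`, where `B` becomes `A`; the result is a `oneSum`. The
exchange relations resum it into terms with `A(ξ_i)` on the far left, each with a factorised
coefficient (`oneSum_eq_leadSum`). There `A(ξ_i)` only yields `∏ b₋(ν_k, ξ_i)`, and what is left is
the partition function without `ν_1` and `ξ_i` (`ZC_succ`). Iterating over the choices of `i` gives
the sum over `S_M`. -/

/-! ### Components of unitarity and of the Yang-Baxter equation. -/

theorem sum_fin_two_pow_two (f : (Fin 2 → Fin 2) → ℂ) :
    ∑ s, f s = ∑ a, ∑ b, f ![a, b] := by
  rw [← (Fin.consEquiv (fun _ : Fin 2 => Fin 2)).sum_comp, Fintype.sum_prod_type]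
  refine Finset.sum_congr rfl fun a _ => ?_
  rw [← (Fin.consEquiv (fun _ : Fin 1 => Fin 2)).sum_comp, Fintype.sum_prod_type]
  refine Finset.sum_congr rfl fun b _ => ?_
  rw [Fintype.sum_unique]
  congr

theorem sum_fin_two_pow_three (f : (Fin 3 → Fin 2) → ℂ) :
    ∑ s, f s = ∑ a, ∑ b, ∑ c, f ![a, b, c] := by
  rw [← (Fin.consEquiv (fun _ : Fin 3 => Fin 2)).sum_comp, Fintype.sum_prod_type]
  refine Finset.sum_congr rfl fun a _ => ?_
  rw [sum_fin_two_pow_two (fun s => f (Fin.consEquiv (fun _ : Fin 3 => Fin 2) (a, s)))]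
  rfl

theorem Weights.RAt_zero_one (w : Weights Λ) (x y : Λ) (a b c a' b' c' : Fin 2) :
    w.RAt (0 : Fin 3) 1 x y ![a, b, c] ![a', b', c'] =
      if c = c' then w.R x y (a, b) (a', b') else 0 := by
  simp [RAt, Fin.forall_fin_succ]

theorem Weights.RAt_zero_two (w : Weights Λ) (x y : Λ) (a b c a' b' c' : Fin 2) :
    w.RAt (0 : Fin 3) 2 x y ![a, b, c] ![a', b', c'] =
      if b = b' then w.R x y (a, c) (a', c') else 0 := by
  simp [RAt, Fin.forall_fin_succ]

theorem Weights.RAt_one_two (w : Weights Λ) (x y : Λ) (a b c a' b' c' : Fin 2) :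
    w.RAt (1 : Fin 3) 2 x y ![a, b, c] ![a', b', c'] =
      if a = a' then w.R x y (b, c) (b', c') else 0 := by
  simp [RAt, Fin.forall_fin_succ]

theorem Weights.YangBaxter.entry {w : Weights Λ} (h : w.YangBaxter) (x y z : Λ)
    (p q r p' q' r' : Fin 2) :
    ∑ i, ∑ j, ∑ k, w.R x y (p, q) (i, j) * w.R x z (i, r) (p', k) * w.R y z (j, k) (q', r') =
    ∑ i, ∑ j, ∑ k, w.R y z (q, r) (j, k) * w.R x z (p, k) (i, r') * w.R x y (i, j) (p', q') := by
  have := congrFun (congrFun (h x y z) ![p, q, r]) ![p', q', r']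
  simp only [Matrix.mul_apply, sum_fin_two_pow_three, Weights.RAt_zero_one, Weights.RAt_zero_two,
    Weights.RAt_one_two, mul_ite, ite_mul, mul_zero, zero_mul, Finset.sum_ite_eq,
    Finset.sum_ite_eq', Finset.mem_univ, if_true, Finset.sum_ite_irrel,
    Finset.sum_const_zero, Fin.sum_univ_two, zero_ne_one, one_ne_zero, if_false, add_zero,
    zero_add] at this ⊢
  linear_combination this

theorem Weights.Unitarity.relations {w : Weights Λ} (h : w.Unitarity) (x y : Λ) :
    w.aMinus x y * w.aMinus y x = 1 ∧
    w.cMinus x y * w.bMinus y x + w.bMinus x y * w.cPlus y x = 0 ∧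
    w.bPlus x y * w.bMinus y x + w.cPlus x y * w.cPlus y x = 1 := by
  have e (s t) := congrFun (congrFun (h x y) s) t
  refine ⟨?_, ?_, ?_⟩
  · have := e ![1, 1] ![1, 1]
    simpa [Matrix.mul_apply, sum_fin_two_pow_two, RAt, Fin.forall_fin_succ, R] using this
  · have := e ![1, 0] ![0, 1]
    simpa [Matrix.mul_apply, sum_fin_two_pow_two, RAt, Fin.forall_fin_succ, R] using this
  · have := e ![0, 1] ![0, 1]
    simpa [Matrix.mul_apply, sum_fin_two_pow_two, RAt, Fin.forall_fin_succ, R] using this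

/-- The components of the Yang-Baxter equation in the two sectors in which it is not trivial. -/
theorem Weights.YangBaxter.relations {w : Weights Λ} (h : w.YangBaxter) (z x y : Λ) :
    w.cMinus z x * w.bMinus x y + w.bMinus z x * w.cMinus z y * w.cPlus x y =
      w.bMinus z y * w.cMinus z x ∧
    w.cMinus z x * w.cMinus x y + w.bMinus z x * w.cMinus z y * w.bPlus x y = w.cMinus z y ∧
    w.cPlus z x * w.bMinus z y =
      w.bMinus x y * w.cPlus z x + w.cMinus x y * w.cPlus z y * w.bMinus z x ∧
    w.bPlus z x * w.bMinus x y + w.cPlus z x * w.cMinus z y * w.cPlus x y =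
      w.bMinus x y * w.bPlus z x + w.cMinus x y * w.cPlus z y * w.cMinus z x ∧
    w.bPlus z x * w.cMinus x y + w.cPlus z x * w.cMinus z y * w.bPlus x y =
      w.cMinus x y * w.bPlus z y ∧
    w.cPlus z y = w.cPlus x y * w.cPlus z x + w.bPlus x y * w.cPlus z y * w.bMinus z x ∧
    w.bPlus z y * w.cPlus x y =
      w.cPlus x y * w.bPlus z x + w.bPlus x y * w.cPlus z y * w.cMinus z x ∧
    w.aMinus z x * w.bMinus z y * w.cMinus x y =
      w.bMinus x y * w.cMinus z y * w.cPlus z x + w.cMinus x y * w.aMinus z y * w.bMinus z x ∧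
    w.aMinus z x * w.cMinus z y * w.aMinus x y =
      w.bMinus x y * w.cMinus z y * w.bPlus z x + w.cMinus x y * w.aMinus z y * w.cMinus z x ∧
    w.cMinus z x * w.cPlus z y * w.bMinus x y + w.bMinus z x * w.aMinus z y * w.cPlus x y =
      w.cPlus x y * w.bMinus z y * w.aMinus z x ∧
    w.cMinus z x * w.cPlus z y * w.cMinus x y + w.bMinus z x * w.aMinus z y * w.bPlus x y =
      w.cPlus x y * w.cMinus z y * w.cPlus z x + w.bPlus x y * w.aMinus z y * w.bMinus z x ∧
    w.cMinus z x * w.bPlus z y * w.aMinus x y =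
      w.cPlus x y * w.cMinus z y * w.bPlus z x + w.bPlus x y * w.aMinus z y * w.cMinus z x ∧
    w.bPlus z x * w.cPlus z y * w.bMinus x y + w.cPlus z x * w.aMinus z y * w.cPlus x y =
      w.aMinus x y * w.cPlus z y * w.aMinus z x ∧
    w.bPlus z x * w.cPlus z y * w.cMinus x y + w.cPlus z x * w.aMinus z y * w.bPlus x y =
      w.aMinus x y * w.bPlus z y * w.cPlus z x := by
  have e (p q r p' q' r' : Fin 2) := h.entry z x y p q r p' q' r'
  simp only [Fin.sum_univ_two] at e
  refine ⟨?_, ?_, ?_, ?_, ?_, ?_, ?_, ?_, ?_, ?_, ?_, ?_, ?_, ?_⟩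
  · simpa [Weights.R] using e 1 0 0 0 1 0
  · simpa [Weights.R] using e 1 0 0 0 0 1
  · simpa [Weights.R] using e 0 1 0 1 0 0
  · simpa [Weights.R] using e 0 1 0 0 1 0
  · simpa [Weights.R] using e 0 1 0 0 0 1
  · simpa [Weights.R] using e 0 0 1 1 0 0
  · simpa [Weights.R] using e 0 0 1 0 1 0
  · simpa [Weights.R] using e 1 1 0 1 0 1
  · simpa [Weights.R] using e 1 1 0 0 1 1
  · simpa [Weights.R] using e 1 0 1 1 1 0
  · simpa [Weights.R] using e 1 0 1 1 0 1
  · simpa [Weights.R] using e 1 0 1 0 1 1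
  · simpa [Weights.R] using e 0 1 1 1 1 0
  · simpa [Weights.R] using e 0 1 1 1 0 1

/-! ### Exchange relations of column operators. -/

/-- The exchange relations of two entries `A`, `B` of a column monodromy matrix: its row with
outgoing state `0`, the incoming state being `0` for `A` and `1` for `B`. -/
structure Weights.Exchange (w : Weights Λ) {S : Type*} [Ring S] [Algebra ℂ S] (A B : Λ → S) :
    Prop where
  AA : ∀ x y, A y * A x = A x * A y
  BB : ∀ x y, B y * B x = w.aMinus x y • (B x * B y)
  BA : ∀ x y, B y * A x = w.bPlus x y • (A x * B y) + w.cMinus x y • (B x * A y)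
  AB : ∀ x y, A y * B x = w.bMinus x y • (B x * A y) + w.cPlus x y • (A x * B y)

/-- The entry `A` of the column monodromy matrix after adding a row with rapidity `ν` which
acts first, as a `2 × 2` matrix over the auxiliary space of that row. -/
def Weights.addRowA (w : Weights Λ) {S : Type*} [Ring S] [Algebra ℂ S] (ν : Λ) (A B : Λ → S)
    (x : Λ) : Matrix (Fin 2) (Fin 2) S :=
  !![A x, w.cPlus ν x • B x; 0, w.bMinus ν x • A x]

/-- The entry `B` of the column monodromy matrix after adding a row with rapidity `ν` which
acts first, as a `2 × 2` matrix over the auxiliary space of that row. -/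
def Weights.addRowB (w : Weights Λ) {S : Type*} [Ring S] [Algebra ℂ S] (ν : Λ) (A B : Λ → S)
    (x : Λ) : Matrix (Fin 2) (Fin 2) S :=
  !![w.bPlus ν x • B x, 0; w.cMinus ν x • A x, w.aMinus ν x • B x]

theorem Weights.Exchange.addRow {w : Weights Λ} {S : Type*} [Ring S] [Algebra ℂ S]
    {A B : Λ → S} (hYB : w.YangBaxter) (h : w.Exchange A B) (ν : Λ) :
    w.Exchange (w.addRowA ν A B) (w.addRowB ν A B) := by
  constructor <;> intro x y
  all_goals
    obtain ⟨h1, h2, h3, -, h5, h6, h7, h8, h9, h10, h11, h12, h13, h14⟩ := hYB.relations ν x y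
    ext i j
    fin_cases i <;> fin_cases j <;>
    simp [Weights.addRowA, Weights.addRowB, Matrix.mul_apply, h.AA x y, h.BB x y, h.BA x y,
      h.AB x y] <;>
    -- With all products reordered by the old relations, each coefficient identity is trivial or one
    -- Yang-Baxter component.
    match_scalars
    all_goals first
    | ring1
    | linear_combination -h1
    | linear_combination -h2
    | linear_combination -h3
    | linear_combination -h5
    | linear_combination -h6
    | linear_combination -h7
    | linear_combination -h8
    | linear_combination -h9
    | linear_combination -h10
    | linear_combination h11
    | linear_combination -h11
    | linear_combination -h12
    | linear_combination -h13
    | linear_combination -h14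

/-! ### Resummation of ordered products with a single `A`. -/

section Columns

variable {S : Type*} [Ring S] [Algebra ℂ S]

/-- The ordered product `B(x_l) ⋯ B(x_1)`. -/
def revProd (B : Λ → S) : List Λ → S
  | [] => 1
  | x :: l => revProd B l * B x

/-- The sum over the products `B(x_l) ⋯ A(x_j) ⋯ B(x_1)` with one factor `A`, with the
weights `f(x_j) ∏_{k < j} g(x_k)`. -/
def oneSum (A B : Λ → S) (f g : Λ → ℂ) : List Λ → S
  | [] => 0
  | x :: l => f x • (revProd B l * A x) + g x • (oneSum A B f g l * B x)

/-- The sum of `A(x_i) B(x_l) ⋯ B(x_1)`, the factor `B(x_i)` being left out, with the weights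
`f(x_i) ∏_{k < i} a₋(x_k, x_i) / ∏_{k ≠ i} b₋(x_k, x_i)`. -/
noncomputable def Weights.leadSum (w : Weights Λ) (A B : Λ → S) : (Λ → ℂ) → List Λ → S
  | _, [] => 0
  | f, x :: l => (f x * (l.map fun y => (w.bMinus y x)⁻¹).prod) • (A x * revProd B l) +
      w.leadSum A B (fun y => f y * (w.aMinus x y / w.bMinus x y)) l * B x

theorem Weights.leadSum_sub (w : Weights Λ) (A B : Λ → S) (f g : Λ → ℂ) (l : List Λ) :
    w.leadSum A B (fun y => f y - g y) l = w.leadSum A B f l - w.leadSum A B g l := by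
  induction l generalizing f g with
  | nil => simp [leadSum]
  | cons x l ih =>
    simp only [leadSum, sub_mul, ih, sub_smul]
    abel

theorem Weights.leadSum_smul (w : Weights Λ) (A B : Λ → S) (c : ℂ) (f : Λ → ℂ) (l : List Λ) :
    w.leadSum A B (fun y => c * f y) l = c • w.leadSum A B f l := by
  induction l generalizing f with
  | nil => simp [leadSum]
  | cons x l ih =>
    simp only [leadSum, mul_assoc, ih, smul_add, smul_smul, smul_mul_assoc]

theorem Weights.leadSum_congr (w : Weights Λ) (A B : Λ → S) {f g : Λ → ℂ} {l : List Λ}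
    (h : ∀ y ∈ l, f y = g y) : w.leadSum A B f l = w.leadSum A B g l := by
  induction l generalizing f g with
  | nil => simp [leadSum]
  | cons x l ih =>
    simp only [leadSum]
    rw [h x (by simp), ih fun y hy => by rw [h y (List.mem_cons_of_mem _ hy)]]

/-- Moving `A(x)` to the right through `B(x_l) ⋯ B(x_1)`. -/
theorem Weights.Exchange.mul_revProd {w : Weights Λ} (hU : w.Unitarity) {A B : Λ → S}
    (h : w.Exchange A B) (x : Λ) {l : List Λ}
    (hb : ∀ y ∈ l, w.bMinus x y ≠ 0 ∧ w.bMinus y x ≠ 0) :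
    (l.map fun y => (w.bMinus y x)⁻¹).prod • (A x * revProd B l) =
      revProd B l * A x - oneSum A B (fun y => w.cMinus x y / w.bMinus x y)
        (fun y => w.aMinus y x / w.bMinus y x) l * B x := by
  induction l with
  | nil => simp [revProd, oneSum]
  | cons y l ih =>
    have ih := ih fun z hz => hb z (List.mem_cons_of_mem _ hz)
    obtain ⟨h1, h2⟩ := hb y (by simp)
    -- Unitarity trades `c₊` for `c₋`; the factor `b₋(y, x)` then cancels against the inverse on the
    -- left-hand side.
    have hc : w.cPlus y x = - (w.cMinus x y / w.bMinus x y) * w.bMinus y x := by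
      have := (hU.relations x y).2.1
      field_simp
      linear_combination this
    simp only [revProd, oneSum, List.map_cons, List.prod_cons]
    rw [mul_smul, ← mul_assoc, ← smul_mul_assoc, ih, sub_mul]
    simp only [mul_assoc, h.AB y x, h.BB y x, hc, add_mul, mul_add, smul_mul_assoc, mul_smul_comm,
      smul_add, smul_sub, smul_smul]
    match_scalars <;> field_simp

/-- The relation between the weights `f`, `g` under which `oneSum` and `leadSum` agree. -/
def Weights.Compatible (w : Weights Λ) (f g : Λ → ℂ) (x y : Λ) : Prop :=
  f y * (g x - w.aMinus x y / w.bMinus x y) = - (f x * (w.cMinus x y / w.bMinus x y))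

theorem Weights.compatible_row {w : Weights Λ} (hU : w.Unitarity) (hYB : w.YangBaxter)
    (ν x y : Λ) (hb : w.bMinus x y ≠ 0) :
    w.Compatible (fun y => w.cMinus ν y / w.aMinus ν y) (fun y => w.bPlus ν y / w.aMinus ν y)
      x y := by
  obtain ⟨-, -, -, -, -, -, -, -, h, -⟩ := hYB.relations ν x y
  have hx := left_ne_zero_of_mul_eq_one (hU.relations ν x).1
  have hy := left_ne_zero_of_mul_eq_one (hU.relations ν y).1
  simp only [Compatible]
  field_simp
  linear_combination -h

/-- These are the weights produced by `mul_revProd`. The Yang-Baxter component behind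
`compatible_row` still works: unitarity eliminates `b₊(z, x)`, and a second component then
eliminates `c₊(z, x)`. -/
theorem Weights.compatible_site {w : Weights Λ} (hU : w.Unitarity) (hYB : w.YangBaxter)
    (z x y : Λ) (hzx : w.bMinus z x ≠ 0) (hxz : w.bMinus x z ≠ 0) (hzy : w.bMinus z y ≠ 0)
    (hxy : w.bMinus x y ≠ 0) :
    w.Compatible (fun y => w.cMinus z y / w.bMinus z y) (fun y => w.aMinus y z / w.bMinus y z)
      x y := by
  obtain ⟨-, -, -, -, -, -, -, -, h, -⟩ := hYB.relations z x y
  have h' : w.aMinus z x * w.bMinus z y * w.cMinus x y =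
      w.bMinus x y * w.cMinus z y * w.cPlus z x + w.cMinus x y * w.aMinus z y * w.bMinus z x :=
    (hYB.relations z x y).2.2.2.2.2.2.2.1
  obtain ⟨u1, u2, u3⟩ := hU.relations z x
  have hc : w.cPlus x z = - w.cMinus z x * w.bMinus x z / w.bMinus z x := by
    field_simp
    linear_combination u2
  have ha : w.aMinus x z = 1 / w.aMinus z x := eq_one_div_of_mul_eq_one_right u1
  have hz := left_ne_zero_of_mul_eq_one u1
  rw [hc] at u3
  field_simp at u3
  simp only [Compatible, ha]
  field_simp
  linear_combination -(w.cMinus z y * w.bMinus x y) * u3 - w.bMinus x z * w.bMinus z x * h +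
    w.bMinus x z * w.cMinus z x * h'

/-- Commuting `A(x)` to the left past the tail leaves a correction that is again a `oneSum`, now
with the site weights. Compatibility says precisely that this correction combines with the other
terms into one product coefficient. -/
theorem Weights.Exchange.oneSum_eq_leadSum {w : Weights Λ} (hU : w.Unitarity)
    (hYB : w.YangBaxter) {A B : Λ → S} (h : w.Exchange A B) {f g : Λ → ℂ} {l : List Λ}
    (hb : l.Pairwise fun x y => w.bMinus x y ≠ 0 ∧ w.bMinus y x ≠ 0)
    (hfg : l.Pairwise (w.Compatible f g)) :
    oneSum A B f g l = w.leadSum A B f l := by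
  induction l generalizing f g with
  | nil => simp [oneSum, leadSum]
  | cons x l ih =>
    rw [List.pairwise_cons] at hb hfg
    -- The induction hypothesis is needed for two pairs of weights, the given one and this one;
    -- hence the generalisation over `f` and `g`.
    have hsite := ih (f := fun y => w.cMinus x y / w.bMinus x y)
      (g := fun y => w.aMinus y x / w.bMinus y x) hb.2 <| by
        refine hb.2.imp_of_mem fun {y z} hy hz hyz => ?_
        exact compatible_site hU hYB x y z (hb.1 y hy).1 (hb.1 y hy).2 (hb.1 z hz).1 hyz.1
    have hlin : w.leadSum A B (fun y => f y * (w.aMinus x y / w.bMinus x y)) l =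
        g x • w.leadSum A B f l +
          f x • w.leadSum A B (fun y => w.cMinus x y / w.bMinus x y) l := by
      rw [← leadSum_smul, ← leadSum_smul, ← sub_eq_iff_eq_add', ← leadSum_sub]
      refine w.leadSum_congr A B fun y hy => ?_
      have := hfg.1 y hy
      simp only [Compatible] at this
      linear_combination -this
    simp only [oneSum, leadSum]
    rw [ih hb.2 hfg.2, hlin, mul_smul, h.mul_revProd hU x hb.1, hsite, add_mul, smul_mul_assoc,
      smul_mul_assoc, smul_sub]
    abel

end Columns

/-! ### Splitting the first site off the row monodromy matrix. -/

/-- The operator on the auxiliary space and the sites `1, …, N` which acts trivially on a new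
first site. -/
def insertSite {N : ℕ} (X : Op (Fin (N + 1))) : Op (Fin (N + 2)) :=
  fun s t => if s 1 = t 1 then X (Fin.removeNth 1 s) (Fin.removeNth 1 t) else 0

theorem insertSite_one {N : ℕ} : insertSite (1 : Op (Fin (N + 1))) = 1 := by
  ext s t
  simp only [insertSite, Matrix.one_apply]
  rw [← ite_and]
  refine if_congr ?_ rfl rfl
  constructor
  · rintro ⟨h1, h2⟩
    rw [← Fin.insertNth_self_removeNth 1 s, h1, h2, Fin.insertNth_self_removeNth]
  · rintro rfl
    simp

theorem insertSite_mul {N : ℕ} (X Y : Op (Fin (N + 1))) :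
    insertSite (X * Y) = insertSite X * insertSite Y := by
  ext s t
  simp only [insertSite, Matrix.mul_apply]
  rw [← (Fin.insertNthEquiv (fun _ : Fin (N + 2) => Fin 2) 1).sum_comp, Fintype.sum_prod_type,
    Fintype.sum_eq_single (s 1) (by simp +contextual [Ne.symm])]
  simp [Fin.insertNthEquiv, Finset.sum_ite_irrel]

theorem insertSite_list_prod {N : ℕ} (l : List (Op (Fin (N + 1)))) :
    insertSite l.prod = (l.map insertSite).prod := by
  induction l with
  | nil => simp [insertSite_one]
  | cons X l ih => simp [insertSite_mul, ih]

theorem Weights.insertSite_RAt (w : Weights Λ) {N : ℕ} (i : Fin N) (x y : Λ) :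
    insertSite (w.RAt (0 : Fin (N + 1)) i.succ x y) = w.RAt (0 : Fin (N + 2)) i.succ.succ x y := by
  ext s t
  simp [insertSite, RAt, Fin.forall_fin_succ, Fin.removeNth, (Fin.succ_ne_zero i).symm,
    ← ite_and]

theorem Weights.monodromy_succ (w : Weights Λ) {N : ℕ} (ξ : Fin (N + 1) → Λ) (μ : Λ) :
    w.monodromy ξ μ =
      insertSite (w.monodromy (fun i => ξ i.succ) μ) * w.RAt (0 : Fin (N + 2)) 1 μ (ξ 0) := by
  simp [monodromy, List.ofFn_succ, insertSite_list_prod, List.map_reverse, insertSite_RAt,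
    List.map_ofFn, Function.comp_def]

theorem insertSite_cons {N : ℕ} (X : Op (Fin (N + 1))) (i j p q : Fin 2) (s t : Fin N → Fin 2) :
    insertSite X (Fin.cons i (Fin.cons p s)) (Fin.cons j (Fin.cons q t)) =
      if p = q then X (Fin.cons i s) (Fin.cons j t) else 0 := by
  have h (i p : Fin 2) (s : Fin N → Fin 2) :
      Fin.removeNth 1 (Fin.cons i (Fin.cons p s) : Fin (N + 2) → Fin 2) = Fin.cons i s := by
    ext k
    refine Fin.cases ?_ (fun k => ?_) k <;> simp [Fin.removeNth]
  rw [insertSite, h, h]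
  rfl

theorem Weights.RAt_cons (w : Weights Λ) {N : ℕ} (x y : Λ) (i j p q : Fin 2)
    (s t : Fin N → Fin 2) :
    w.RAt (0 : Fin (N + 2)) 1 x y (Fin.cons i (Fin.cons p s)) (Fin.cons j (Fin.cons q t)) =
      if s = t then w.R x y (i, p) (j, q) else 0 := by
  simp [RAt, Fin.forall_fin_succ, funext_iff, Fin.succ_succ_ne_one]

theorem sum_cons {N : ℕ} {M : Type*} [AddCommMonoid M] (f : (Fin (N + 1) → Fin 2) → M) :
    ∑ s, f s = ∑ p, ∑ t, f (Fin.cons p t) := by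
  rw [← (Fin.consEquiv (fun _ : Fin (N + 1) => Fin 2)).sum_comp, Fintype.sum_prod_type]
  rfl

theorem Weights.monodromy_succ_apply (w : Weights Λ) {N : ℕ} (ξ : Fin (N + 1) → Λ) (μ : Λ)
    (i j p q : Fin 2) (s t : Fin N → Fin 2) :
    w.monodromy ξ μ (Fin.cons i (Fin.cons p s)) (Fin.cons j (Fin.cons q t)) =
      ∑ k, w.monodromy (fun i => ξ i.succ) μ (Fin.cons i s) (Fin.cons k t) *
        w.R μ (ξ 0) (k, p) (j, q) := by
  rw [monodromy_succ, Matrix.mul_apply]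
  simp only [sum_cons, insertSite_cons, RAt_cons]
  simp

/-! ### Dictionary between rows and columns. -/

section Columns
variable {S : Type*} [Ring S]

/-- The product `X_N ⋯ X_1` with `X_i = A(ξ_i)` if `t_i = 0` and `X_i = B(ξ_i)` if `t_i = 1`. -/
def colProd (A B : Λ → S) {N : ℕ} (ξ : Fin N → Λ) (t : Fin N → Fin 2) : S :=
  (List.ofFn fun i => (![A, B] (t i)) (ξ i)).reverse.prod

theorem colProd_cons (A B : Λ → S) {N : ℕ} (ξ : Fin (N + 1) → Λ) (p : Fin 2) (t : Fin N → Fin 2) :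
    colProd A B ξ (Fin.cons p t) =
      colProd A B (fun i => ξ i.succ) t * (![A, B] p) (ξ 0) := by
  simp [colProd, List.ofFn_succ]

theorem colProd_one (A B : Λ → S) {N : ℕ} (ξ : Fin N → Λ) :
    colProd A B ξ (fun _ => 1) = revProd B (List.ofFn ξ) := by
  induction N with
  | zero => simp [colProd, revProd]
  | succ N ih =>
    have := ih fun i => ξ i.succ
    simp only [colProd] at this
    simp [colProd, List.ofFn_succ, revProd, ← this]

variable [Algebra ℂ S]

theorem Weights.addRow_apply (w : Weights Λ) (A B : Λ → S) (ν x : Λ) (i j q : Fin 2) :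
    (![w.addRowA ν A B, w.addRowB ν A B] q) x i j =
      ∑ p, w.R ν x (i, p) (j, q) • (![A, B] p) x := by
  fin_cases i <;> fin_cases j <;> fin_cases q <;> simp [addRowA, addRowB, R]

/-- Adding a row to the columns amounts to the action of a row monodromy matrix. -/
theorem Weights.colProd_addRow (w : Weights Λ) (A B : Λ → S) (ν : Λ) {N : ℕ} (ξ : Fin N → Λ)
    (t : Fin N → Fin 2) (i j : Fin 2) :
    colProd (w.addRowA ν A B) (w.addRowB ν A B) ξ t i j =
      ∑ r, w.monodromy ξ ν (Fin.cons i r) (Fin.cons j t) • colProd A B ξ r := by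
  induction N generalizing i j with
  | zero =>
    rw [Fintype.sum_unique]
    simp [colProd, monodromy, Matrix.one_apply, Fin.cons_inj, Subsingleton.elim _ t, ite_smul]
  | succ N ih =>
    obtain ⟨q, t, rfl⟩ : ∃ q t', t = Fin.cons q t' :=
      ⟨t 0, Fin.tail t, (Fin.cons_self_tail t).symm⟩
    rw [colProd_cons, Matrix.mul_apply]
    simp only [ih, addRow_apply, sum_cons,
      monodromy_succ_apply, colProd_cons, Finset.sum_smul, Finset.sum_mul_sum, smul_mul_smul_comm]
    rw [Finset.sum_comm]
    conv_rhs => rw [Finset.sum_comm]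
    exact Finset.sum_congr rfl fun r _ => Finset.sum_comm

theorem Weights.revProd_addRowB_one_one (w : Weights Λ) (A B : Λ → S) (ν : Λ) (l : List Λ) :
    revProd (w.addRowB ν A B) l 1 1 = (l.map (w.aMinus ν)).prod • revProd B l := by
  induction l with
  | nil => simp [revProd]
  | cons x l ih =>
    simp [revProd, Matrix.mul_apply, ih, addRowB, smul_smul, mul_comm]

/-- `addRowB` is lower triangular: columns before the flip contribute `b₊`, the flip `c₋`, later
columns `a₋`. Pulling out all the `a₋`, nonzero by unitarity, leaves weights local to each site. -/
theorem Weights.revProd_addRowB_one_zero {w : Weights Λ} (hU : w.Unitarity) (A B : Λ → S) (ν : Λ)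
    (l : List Λ) :
    revProd (w.addRowB ν A B) l 1 0 = (l.map (w.aMinus ν)).prod •
      oneSum A B (fun y => w.cMinus ν y / w.aMinus ν y) (fun y => w.bPlus ν y / w.aMinus ν y) l := by
  induction l with
  | nil => simp [revProd, oneSum]
  | cons x l ih =>
    have hx := left_ne_zero_of_mul_eq_one (hU.relations ν x).1
    simp only [revProd, Matrix.mul_apply, Fin.sum_univ_two, ih, revProd_addRowB_one_one, oneSum,
      List.map_cons, List.prod_cons]
    simp [addRowB]
    match_scalars <;> field_simp

theorem Weights.leadSum_ofFn (w : Weights Λ) (A B : Λ → S) (f : Λ → ℂ) {n : ℕ}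
    (ξ : Fin (n + 1) → Λ) :
    w.leadSum A B f (List.ofFn ξ) =
      ∑ i, (f (ξ i) * ∏ m, w.theta ξ (i.succAbove m) i / w.bMinus (ξ (i.succAbove m)) (ξ i)) •
        (A (ξ i) * revProd B (List.ofFn fun m => ξ (i.succAbove m))) := by
  induction n generalizing f with
  | zero => simp [leadSum, revProd]
  | succ n ih =>
    rw [List.ofFn_succ, leadSum, ih, Finset.sum_mul, Fin.sum_univ_succ (n := n + 1)]
    congr 1
    · simp [-List.ofFn_succ, theta, List.map_ofFn, List.prod_ofFn, Function.comp_def]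
    · refine Finset.sum_congr rfl fun j _ => ?_
      rw [Fin.prod_univ_succ, List.ofFn_succ]
      simp [theta, revProd, mul_assoc]

end Columns

/-- The operators `C(ν_n) ⋯ C(ν_1)` on any number of sites, contracted with `⟨0|`, are realised by
column operators `A`, `B` which satisfy the exchange relations. -/
theorem Weights.YangBaxter.exists_columns {w : Weights Λ} (hYB : w.YangBaxter) {n : ℕ}
    (ν : Fin n → Λ) :
    ∃ (S : Type) (_ : Ring S) (_ : Algebra ℂ S) (A B : Λ → S) (φ : S →ₗ[ℂ] ℂ),
      w.Exchange A B ∧ (∀ x m, φ (A x * m) = (∏ k, w.bMinus (ν k) x) * φ m) ∧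
      ∀ (N : ℕ) (ξ : Fin N → Λ) (t : Fin N → Fin 2),
        (List.ofFn fun k => w.C ξ (ν k)).reverse.prod (fun _ => 0) t = φ (colProd A B ξ t) := by
  induction n with
  | zero =>
    -- Without rows a column preserves its state, so `A = 1` and `B = 0`.
    refine ⟨ℂ, inferInstance, inferInstance, fun _ => 1, fun _ => 0, LinearMap.id,
      ⟨by simp, by simp, by simp, by simp⟩, by simp, fun N ξ t => ?_⟩
    induction N with
    | zero => simp [colProd, Subsingleton.elim _ t]
    | succ N ih =>
      obtain ⟨q, t, rfl⟩ : ∃ q t', t = Fin.cons q t' :=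
        ⟨t 0, Fin.tail t, (Fin.cons_self_tail t).symm⟩
      have := ih (fun i => ξ i.succ) t
      simp only [List.ofFn_zero, List.reverse_nil, List.prod_nil, Matrix.one_apply, funext_iff,
        LinearMap.id_apply] at this
      fin_cases q
      · simpa [colProd_cons, Matrix.one_apply, funext_iff, Fin.forall_fin_succ] using this
      · simp [colProd_cons, funext_iff, Fin.forall_fin_succ]
  | succ n ih =>
    obtain ⟨S, _, _, A, B, φ, hE, hA, hC⟩ := ih fun k => ν k.succ
    refine ⟨Matrix (Fin 2) (Fin 2) S, inferInstance, inferInstance, w.addRowA (ν 0) A B,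
      w.addRowB (ν 0) A B, φ ∘ₗ Matrix.entryLinearMap ℂ S 1 0, hE.addRow hYB (ν 0),
      fun x m => ?_, fun N ξ t => ?_⟩
    -- The lower row of `addRowA` has only its diagonal entry `b₋ A`, so each row contributes one
    -- factor `b₋`.
    · simp [addRowA, Matrix.vecMul_eq_sum, Fin.sum_univ_two, hA, Fin.prod_univ_succ, mul_assoc]
    · simp [List.ofFn_succ, Matrix.mul_apply, hC, colProd_addRow, C, mul_comm]

/-! ### Recursion in the number of rapidities and the sum over permutations. -/

/-- The recursion which removes the first rapidity. -/
theorem Weights.ZC_succ {w : Weights Λ} (hU : w.Unitarity) (hYB : w.YangBaxter) {n : ℕ}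
    (ν ξ : Fin (n + 1) → Λ) (hb : ∀ i j, i ≠ j → w.bMinus (ξ i) (ξ j) ≠ 0) :
    w.ZC ν ξ = ∑ i, w.cMinus (ν 0) (ξ i) *
      (∏ m, w.aMinus (ν 0) (ξ (i.succAbove m)) *
        (w.theta ξ (i.succAbove m) i / w.bMinus (ξ (i.succAbove m)) (ξ i))) *
      (∏ k : Fin n, w.bMinus (ν k.succ) (ξ i)) *
      w.ZC (fun k => ν k.succ) (fun m => ξ (i.succAbove m)) := by
  obtain ⟨S, _, _, A, B, φ, hE, hA, hC⟩ := hYB.exists_columns fun k => ν k.succ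
  have hZ {N : ℕ} (ν ξ : Fin N → Λ) :
      w.ZC ν ξ = (List.ofFn fun k => w.C ξ (ν k)).reverse.prod (fun _ => 0) (fun _ => 1) := by
    simp [ZC, state0, state1]
  have hpair : (List.ofFn ξ).Pairwise fun x y => w.bMinus x y ≠ 0 ∧ w.bMinus y x ≠ 0 :=
    List.pairwise_ofFn.2 fun i j h => ⟨hb i j h.ne, hb j i h.ne'⟩
  have h0 : w.ZC ν ξ = φ (revProd (w.addRowB (ν 0) A B) (List.ofFn ξ) 1 0) := by
    rw [hZ, ← colProd_one, colProd_addRow (t := fun _ => 1)]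
    simp [List.ofFn_succ, Matrix.mul_apply, hC, C, mul_comm]
  rw [h0, revProd_addRowB_one_zero hU, hE.oneSum_eq_leadSum hU hYB hpair
    (hpair.imp fun h => compatible_row hU hYB _ _ _ h.1), leadSum_ofFn, map_smul, map_sum,
    Finset.smul_sum]
  refine Finset.sum_congr rfl fun i _ => ?_
  -- The factor of site `i` in `∏ a₋(ν 0, ·)` cancels the denominator of `c₋ / a₋`.
  have hi := left_ne_zero_of_mul_eq_one (hU.relations (ν 0) (ξ i)).1
  rw [map_smul, hA, hZ, hC, colProd_one, List.map_ofFn, List.prod_ofFn,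
    Fin.prod_univ_succAbove _ i, Finset.prod_mul_distrib]
  simp only [smul_eq_mul, Function.comp_apply]
  field_simp

theorem Weights.theta_comp (w : Weights Λ) {M L : ℕ} (ξ : Fin L → Λ) {l : Fin M → Fin L}
    (hl : StrictMono l) (i j : Fin M) :
    w.theta ξ (l i) (l j) = w.theta (fun m => ξ (l m)) i j := by
  simp [theta, hl.lt_iff_lt]

/-- The permutations of `Fin (n + 1)`, sorted by the image of `0`. -/
theorem sum_perm_succAbove {n : ℕ} {N : Type*} [AddCommMonoid N]
    (f : (Fin (n + 1) → Fin (n + 1)) → N) :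
    ∑ σ : Equiv.Perm (Fin (n + 1)), f σ =
      ∑ i : Fin (n + 1), ∑ τ : Equiv.Perm (Fin n), f (Fin.cons i fun k => i.succAbove (τ k)) := by
  -- The first permutation fixes `0` and acts as `τ` on successors; `cycleRange.symm` then sends `0`
  -- to `i` and `k.succ` to `i.succAbove k`.
  let e (p : Fin (n + 1) × Equiv.Perm (Fin n)) : Equiv.Perm (Fin (n + 1)) :=
    (Equiv.Perm.decomposeFin.symm (0, p.2)).trans p.1.cycleRange.symm
  have he (p) : (e p : Fin (n + 1) → Fin (n + 1)) = Fin.cons p.1 fun k => p.1.succAbove (p.2 k) := by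
    ext k
    refine Fin.cases ?_ (fun k => ?_) k <;> simp [e]
  have hinj : Function.Injective e := fun p q h => by
    have h : (e p : Fin (n + 1) → Fin (n + 1)) = e q := congrArg _ h
    rw [he, he, Fin.cons_inj] at h
    obtain ⟨i, σ⟩ := p
    obtain ⟨j, τ⟩ := q
    obtain ⟨rfl : i = j, h⟩ := h
    exact Prod.ext rfl (Equiv.ext fun k => Fin.succAbove_right_injective (congrFun h k))
  have hbij : Function.Bijective e := (Fintype.bijective_iff_injective_and_card e).2
    ⟨hinj, by simp [Fintype.card_perm, Nat.factorial_succ]⟩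
  rw [← Fintype.sum_prod_type' (f := fun i (τ : Equiv.Perm (Fin n)) =>
    f (Fin.cons i fun k => i.succAbove (τ k))), ← hbij.sum_comp]
  simp only [he]

theorem Weights.ZC_eq_sum {w : Weights Λ} (hU : w.Unitarity) (hYB : w.YangBaxter) {M : ℕ}
    (ν ξ : Fin M → Λ) (hb : ∀ i j, i ≠ j → w.bMinus (ξ i) (ξ j) ≠ 0) :
    w.ZC ν ξ = ∑ σ : Equiv.Perm (Fin M), (∏ i, w.cMinus (ν i) (ξ (σ i))) *
      ∏ j, ∏ k ∈ Finset.Ioi j, w.bMinus (ν k) (ξ (σ j)) * w.aMinus (ν j) (ξ (σ k)) *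
        w.theta ξ (σ k) (σ j) / w.bMinus (ξ (σ k)) (ξ (σ j)) := by
  induction M with
  | zero => simp [ZC, state0, state1, Subsingleton.elim _ (1 : Fin 0 → Fin 2)]
  | succ n ih =>
    rw [ZC_succ hU hYB ν ξ hb, sum_perm_succAbove fun σ => (∏ i, w.cMinus (ν i) (ξ (σ i))) *
      ∏ j, ∏ k ∈ Finset.Ioi j, w.bMinus (ν k) (ξ (σ j)) * w.aMinus (ν j) (ξ (σ k)) *
        w.theta ξ (σ k) (σ j) / w.bMinus (ξ (σ k)) (ξ (σ j))]
    refine Finset.sum_congr rfl fun i _ => ?_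
    rw [ih _ _ fun j k hjk => hb _ _ (Fin.succAbove_right_injective.ne hjk), Finset.mul_sum]
    refine Finset.sum_congr rfl fun τ _ => ?_
    rw [← Equiv.prod_comp τ fun m => w.aMinus (ν 0) (ξ (i.succAbove m)) *
      (w.theta ξ (i.succAbove m) i / w.bMinus (ξ (i.succAbove m)) (ξ i))]
    simp only [Fin.prod_univ_succ, Fin.Ioi_zero_eq_map, Fin.Ioi_succ, Finset.prod_map,
      Fin.coe_succEmb, Fin.cons_zero, Fin.cons_succ, mul_div_assoc, Finset.prod_mul_distrib,
      w.theta_comp ξ (Fin.strictMono_succAbove i)]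
    ring

end SixVertex

theorem mainTheorem5 {Λ : Type*} (w : SixVertex.Weights Λ)
    (hU : w.Unitarity) (hYB : w.YangBaxter)
    {L M : ℕ} (ξ : Fin L → Λ) (l : Fin M → Fin L) (hl : StrictMono l) (ν : Fin M → Λ)
    (hb : ∀ i j : Fin M, i ≠ j → w.bMinus (ξ (l i)) (ξ (l j)) ≠ 0) :
    w.ZC ν (fun i => ξ (l i)) =
      ∑ σ : Equiv.Perm (Fin M),
        (∏ i : Fin M, w.cMinus (ν i) (ξ (l (σ i)))) *
          ∏ j : Fin M, ∏ k ∈ Finset.Ioi j,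
            w.bMinus (ν k) (ξ (l (σ j))) * w.aMinus (ν j) (ξ (l (σ k))) *
                w.theta ξ (l (σ k)) (l (σ j)) /
              w.bMinus (ξ (l (σ k))) (ξ (l (σ j))) := by
  -- `θ` sees only the order of the labels, which `l` preserves.
  simp only [w.theta_comp ξ hl]
  exact SixVertex.Weights.ZC_eq_sum hU hYB ν (fun i => ξ (l i)) hb
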